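/- For a finite graph $G$, let $i(G)$ denote the number of independent sets of $G$ (the empty set included). Let $G$ be a triangle-free graph with $n\ge 1$ vertices and average degree $t$. Then $i(G)\ge 2^{t}$, and if $t\ge 1$, then \[ i(G) \ \ge\ \max\Big\{ \exp\Big( \big(1-n^{-1/12}\big)\,\frac12\,\frac{n}{t}\,\ln t\,\Big(\frac12 \ln t-1\Big)\Big),\ 2^{t}\Big\}. \] Consequently, there is a function $\varepsilon:\mathbb{N}\to\mathbb{R}$ with $\varepsilon(n)\to 0$ as $n\to\infty$ such that every triangle-free graph $H$ on $n$ vertices satisfies \[ i(H)\ \ge\ \exp\Big( (1-\varepsilon(n))\,\frac{\sqrt{n\ln 2}\,\ln n}{4}\Big). \] -/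

import Mathlib

noncomputable section

open Classical in
/-- The number of independent sets of a finite graph (the empty set is counted). -/
def SimpleGraph.numIndepSets {V : Type*} [Fintype V] (G : SimpleGraph V) : ℕ :=
  (Finset.univ.filter fun s : Finset V => G.IsIndepSet (s : Set V)).card

open Classical in
/-- The average degree of a finite graph. -/
def SimpleGraph.avgDegree {V : Type*} [Fintype V] (G : SimpleGraph V) : ℝ :=
  (∑ v, (G.degree v : ℝ)) / (Fintype.card V : ℝ)

end

/-!
In a triangle-free graph neighbourhoods are independent, so the subsets of the neighbourhood of a
vertex of maximum degree are at least `2 ^ t` independent sets.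

For the other bound, keep every vertex independently with probability `p = 1 / √t`. The random
induced subgraph has about `p n` vertices and average degree about `√t`, and Shearer's theorem
gives an independent set of size about `(p n / √t) log √t` in it. A given independent set `I`
survives with probability `p ^ |I|`, so `i(G)` is the expectation of `∑ p ^ (-|I|)` over the
surviving independent sets `I`, and Jensen's inequality bounds it from below by `p ^ (-μ)`, where
`μ` is the expected size of Shearer's set. Both fluctuating quantities, the number of vertices and
the number of edges, enter linearly as soon as Shearer's bound `n f(d)`, with `f` convex, is
replaced by its tangent at `d = √t`; so no concentration inequality is needed.

The first bound increases with `t`, while the second one holds for every `t` above the average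
degree. At the `t` for which `t log 2` is the required exponent, either bound is sufficient.
-/

/-- Shearer's function `a ↦ (a log a - a + 1) / (a - 1) ^ 2`, as an integral: this removes the
singularity at `a = 1` and makes convexity in `a` visible in the integrand. -/
noncomputable def shearerFun (a : ℝ) : ℝ :=
  ∫ x in (0 : ℝ)..1, (1 - x) / (1 - x + a * x)

/-- The function `-f'` for Shearer's function `f`, obtained by differentiating under the integral
sign; it is nonnegative because `f` is decreasing. -/
noncomputable def shearerSlope (a : ℝ) : ℝ :=
  ∫ x in (0 : ℝ)..1, x * (1 - x) / (1 - x + a * x) ^ 2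

section Shearer

open Set MeasureTheory intervalIntegral

variable {a b x : ℝ}

theorem one_sub_add_mul_pos (ha : 0 < a) (hx : x ∈ Icc (0 : ℝ) 1) : 0 < 1 - x + a * x := by
  obtain ⟨hx0, hx1⟩ := hx
  rcases hx0.eq_or_lt with rfl | hx0
  · norm_num
  · nlinarith [mul_pos ha hx0]

theorem intervalIntegrable_shearerFun (ha : 0 < a) :
    IntervalIntegrable (fun x ↦ (1 - x) / (1 - x + a * x)) volume 0 1 :=
  ContinuousOn.intervalIntegrable_of_Icc zero_le_one <|
    ContinuousOn.div (by fun_prop) (by fun_prop) fun _ hx ↦ (one_sub_add_mul_pos ha hx).ne'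

theorem intervalIntegrable_shearerSlope (ha : 0 < a) :
    IntervalIntegrable (fun x ↦ x * (1 - x) / (1 - x + a * x) ^ 2) volume 0 1 :=
  ContinuousOn.intervalIntegrable_of_Icc zero_le_one <|
    ContinuousOn.div (by fun_prop) (by fun_prop)
      fun _ hx ↦ pow_ne_zero 2 (one_sub_add_mul_pos ha hx).ne'

theorem shearerSlope_nonneg (a : ℝ) : 0 ≤ shearerSlope a :=
  integral_nonneg zero_le_one fun _ ⟨hx0, hx1⟩ ↦
    div_nonneg (mul_nonneg hx0 (sub_nonneg.mpr hx1)) (sq_nonneg _)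

theorem intervalIntegrable_linear_combination (ha : 0 < a) (c d : ℝ) :
    IntervalIntegrable
      (fun x ↦ c * ((1 - x) / (1 - x + a * x)) + d * (x * (1 - x) / (1 - x + a * x) ^ 2))
      volume 0 1 :=
  ((intervalIntegrable_shearerFun ha).const_mul c).add
    ((intervalIntegrable_shearerSlope ha).const_mul d)

theorem mul_shearerFun_add_mul_shearerSlope (ha : 0 < a) (c d : ℝ) :
    c * shearerFun a + d * shearerSlope a = ∫ x in (0 : ℝ)..1,
      (c * ((1 - x) / (1 - x + a * x)) + d * (x * (1 - x) / (1 - x + a * x) ^ 2)) := by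
  rw [integral_add ((intervalIntegrable_shearerFun ha).const_mul c)
    ((intervalIntegrable_shearerSlope ha).const_mul d), intervalIntegral.integral_const_mul,
    intervalIntegral.integral_const_mul, shearerFun, shearerSlope]

theorem shearerFun_ode (ha : 0 < a) :
    (a + 1) * shearerFun a + (a - a ^ 2) * shearerSlope a = 1 := by
  have hderiv (x : ℝ) (hx : x ∈ uIcc (0 : ℝ) 1) :
      HasDerivAt (fun x ↦ x + a * x * (1 - x) / (1 - x + a * x))
        ((a + 1) * ((1 - x) / (1 - x + a * x))
          + (a - a ^ 2) * (x * (1 - x) / (1 - x + a * x) ^ 2)) x := by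
    rw [uIcc_of_le zero_le_one] at hx
    have hden : 1 - x + a * x ≠ 0 := (one_sub_add_mul_pos ha hx).ne'
    have hnum : HasDerivAt (fun x ↦ a * x * (1 - x)) (a * (1 - x) - a * x) x :=
      (((hasDerivAt_id x).const_mul a).mul ((hasDerivAt_id x).const_sub 1)).congr_deriv
        (by rw [id]; ring)
    have hden' : HasDerivAt (fun x ↦ 1 - x + a * x) (-1 + a) x :=
      (((hasDerivAt_id x).const_sub 1).add ((hasDerivAt_id x).const_mul a)).congr_deriv
        (by rw [mul_one])
    refine ((hasDerivAt_id x).add (hnum.div hden' hden)).congr_deriv ?_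
    field_simp
    ring
  rw [mul_shearerFun_add_mul_shearerSlope ha, integral_eq_sub_of_hasDerivAt hderiv
    (intervalIntegrable_linear_combination ha _ _)]
  simp

theorem inv_add_sub_div_sq_le_inv (ha : 0 < a) (hb : 0 < b) :
    a⁻¹ + (a - b) / a ^ 2 ≤ b⁻¹ := by
  have hgap : b⁻¹ - (a⁻¹ + (a - b) / a ^ 2) = (a - b) ^ 2 / (b * a ^ 2) := by
    field_simp
    ring
  rw [← sub_nonneg, hgap]
  positivity

theorem shearerFun_add_mul_shearerSlope_le (ha : 0 < a) (hb : 0 < b) :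
    shearerFun a + (a - b) * shearerSlope a ≤ shearerFun b := by
  rw [← one_mul (shearerFun a), mul_shearerFun_add_mul_shearerSlope ha]
  refine integral_mono_on zero_le_one (intervalIntegrable_linear_combination ha _ _)
    (intervalIntegrable_shearerFun hb) fun x hx ↦ ?_
  have hx1 : 0 ≤ 1 - x := sub_nonneg.mpr hx.2
  calc 1 * ((1 - x) / (1 - x + a * x)) + (a - b) * (x * (1 - x) / (1 - x + a * x) ^ 2)
      = (1 - x) * ((1 - x + a * x)⁻¹
          + ((1 - x + a * x) - (1 - x + b * x)) / (1 - x + a * x) ^ 2) := by ring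
    _ ≤ (1 - x) * (1 - x + b * x)⁻¹ := by
        gcongr
        exact inv_add_sub_div_sq_le_inv (one_sub_add_mul_pos ha hx) (one_sub_add_mul_pos hb hx)
    _ = (1 - x) / (1 - x + b * x) := rfl

theorem shearerFun_add_self_mul_shearerSlope_le_one (ha : 0 < a) :
    shearerFun a + a * shearerSlope a ≤ 1 := by
  have hone : ∫ _ in (0 : ℝ)..1, (1 : ℝ) = 1 := by simp
  rw [← one_mul (shearerFun a), mul_shearerFun_add_mul_shearerSlope ha]
  refine (integral_mono_on zero_le_one (intervalIntegrable_linear_combination ha _ _)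
    intervalIntegrable_const fun x hx ↦ ?_).trans_eq hone
  have hden : 1 - x + a * x ≠ 0 := (one_sub_add_mul_pos ha hx).ne'
  generalize 1 - x = y at hden ⊢
  have hgap : 1 - (1 * (y / (y + a * x)) + a * (x * y / (y + a * x) ^ 2))
      = (a * x) ^ 2 / (y + a * x) ^ 2 := by
    field_simp
    ring
  rw [← sub_nonneg, hgap]
  positivity

theorem integral_inv_one_add_mul (ha : 0 < a) :
    ∫ x in (0 : ℝ)..1, (1 + a * x)⁻¹ = Real.log (1 + a) / a := by
  rw [integral_comp_add_mul (fun u ↦ u⁻¹) ha.ne', mul_zero, add_zero, mul_one,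
    integral_inv_of_pos one_pos (by positivity), div_one, smul_eq_mul, inv_mul_eq_div]

theorem log_sub_one_div_le_shearerFun (ha : 0 < a) : (Real.log a - 1) / a ≤ shearerFun a := by
  have hint : IntervalIntegrable (fun x ↦ (1 + a * x)⁻¹) volume 0 1 :=
    ContinuousOn.intervalIntegrable_of_Icc zero_le_one <|
      ContinuousOn.inv₀ (by fun_prop) fun x hx ↦ (by nlinarith [hx.1] : 1 + a * x ≠ 0)
  calc (Real.log a - 1) / a ≤ (Real.log (1 + a) - 1) / a := by gcongr; linarith
    _ = ∫ x in (0 : ℝ)..1, ((1 + a * x)⁻¹ - a⁻¹) := by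
        rw [integral_sub hint intervalIntegrable_const, integral_inv_one_add_mul ha]
        simp [sub_div]
    _ ≤ shearerFun a := by
        refine integral_mono_on zero_le_one (hint.sub intervalIntegrable_const)
          (intervalIntegrable_shearerFun ha) fun x hx ↦ ?_
        have hd := one_sub_add_mul_pos ha hx
        have hx_le : x / (1 - x + a * x) ≤ a⁻¹ := by
          rw [div_le_iff₀ hd, inv_mul_eq_div, le_div_iff₀ ha]
          linarith [hx.2]
        rw [sub_div, one_div]
        gcongr
        linarith [hx.1]

end Shearer

/-- The tangent at average degree `a` to `(n, m) ↦ n f(m / n)`, Shearer's lower bound for the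
independence number of a triangle-free graph with `n` vertices and degree sum `m`. -/
noncomputable def shearerTangent (a n m : ℝ) : ℝ :=
  shearerFun a * n + shearerSlope a * (a * n - m)

theorem shearerTangent_le_shearerTangent_div {a n m : ℝ} (ha : 0 < a) (hn : 0 < n) (hm : 0 < m) :
    shearerTangent a n m ≤ shearerTangent (m / n) n m := by
  calc shearerTangent a n m = (shearerFun a + (a - m / n) * shearerSlope a) * n := by
        rw [shearerTangent]
        field_simp
    _ ≤ shearerFun (m / n) * n := by
        gcongr
        exact shearerFun_add_mul_shearerSlope_le ha (div_pos hm hn)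
    _ = shearerTangent (m / n) n m := by
        rw [shearerTangent, div_mul_cancel₀ m hn.ne', sub_self, mul_zero, add_zero]

theorem shearerTangent_zero_le {a n : ℝ} (ha : 0 < a) (hn : 0 ≤ n) :
    shearerTangent a n 0 ≤ n := by
  rw [shearerTangent]
  linarith [mul_le_mul_of_nonneg_right (shearerFun_add_self_mul_shearerSlope_le_one ha) hn]

section Induction

open Finset

variable {V : Type*} {G : SimpleGraph V} [DecidableRel G.Adj] {W N U : Finset V} {v : V}

theorem card_interedges_eq_sum (A B : Finset V) :
    #(G.interedges A B) = ∑ v ∈ A, #{u ∈ B | G.Adj v u} := by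
  simp only [G.interedges_def, card_filter, sum_product]

theorem interedges_self_eq_empty_iff :
    G.interedges W W = ∅ ↔ G.IsIndepSet (W : Set V) := by
  refine ⟨fun h x hx y hy _ hxy ↦ ?_, fun h ↦ eq_empty_of_forall_notMem fun ⟨x, y⟩ he ↦ ?_⟩
  · exact eq_empty_iff_forall_notMem.mp h (x, y) (G.mk_mem_interedges_iff.mpr ⟨hx, hy, hxy⟩)
  · obtain ⟨hx, hy, hxy⟩ := G.mk_mem_interedges_iff.mp he
    exact h hx hy hxy.ne hxy

theorem card_interedges_add_two_mul_le (hN : G.IsIndepSet (N : Set V)) (hNW : N ⊆ W) (hUW : U ⊆ W)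
    (hUN : Disjoint U N) :
    #(G.interedges U U) + 2 * #(G.interedges N W) ≤ #(G.interedges W W) := by
  classical
  have hNN : Disjoint (G.interedges N W) (G.interedges W N) := by
    refine Finset.disjoint_left.mpr fun ⟨x, y⟩ hNW hWN ↦ ?_
    obtain ⟨hx, -, hxy⟩ := G.mk_mem_interedges_iff.mp hNW
    exact hN hx (G.mk_mem_interedges_iff.mp hWN).2.1 hxy.ne hxy
  have hU : Disjoint (G.interedges U U) (G.interedges N W ∪ G.interedges W N) :=
    disjoint_union_right.mpr
      ⟨(G.interedges_disjoint_left hUN W).mono_left (G.interedges_mono subset_rfl hUW),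
        (G.interedges_disjoint_right W hUN).mono_left (G.interedges_mono hUW subset_rfl)⟩
  have := G.symm
  calc #(G.interedges U U) + 2 * #(G.interedges N W)
      = #(G.interedges U U ∪ (G.interedges N W ∪ G.interedges W N)) := by
        rw [card_union_of_disjoint hU, card_union_of_disjoint hNN, two_mul]
        exact congrArg (fun k ↦ _ + (_ + k)) (Rel.card_interedges_comm N W)
    _ ≤ #(G.interedges W W) := card_le_card <|
        union_subset (G.interedges_mono hUW hUW) <|
          union_subset (G.interedges_mono hNW subset_rfl) (G.interedges_mono subset_rfl hNW)

theorem sum_card_interedges_neighbors (W : Finset V) :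
    ∑ v ∈ W, #(G.interedges {u ∈ W | G.Adj v u} W) = ∑ u ∈ W, #{w ∈ W | G.Adj u w} ^ 2 := by
  simp only [card_interedges_eq_sum, sum_filter]
  rw [sum_comm]
  refine sum_congr rfl fun u _ ↦ ?_
  rw [← sum_filter, sum_const, smul_eq_mul, sq]
  simp only [G.adj_comm]

theorem sq_card_interedges_le (W : Finset V) :
    #(G.interedges W W) ^ 2 ≤ #W * ∑ v ∈ W, #(G.interedges {u ∈ W | G.Adj v u} W) := by
  rw [sum_card_interedges_neighbors, card_interedges_eq_sum]
  exact sq_sum_le_card_mul_sum_sq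

variable (G) in
/-- A bound for the decrease of `shearerTangent a` when a vertex `v` and its neighbours, which are
pairwise nonadjacent, are deleted from `W`. -/
noncomputable def shearerDrop (W : Finset V) (v : V) (a : ℝ) : ℝ :=
  (#{u ∈ W | G.Adj v u} + 1) * (shearerFun a + a * shearerSlope a)
    - 2 * #(G.interedges {u ∈ W | G.Adj v u} W) * shearerSlope a

theorem sum_shearerDrop_le_card (hW : W.Nonempty) {t : ℝ} (ht : 0 < t)
    (htW : (#(G.interedges W W) : ℝ) = t * #W) :
    ∑ v ∈ W, shearerDrop G W v t ≤ #W := by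
  have hn : (0 : ℝ) < #W := mod_cast hW.card_pos
  have hdeg : ∑ v ∈ W, (#{u ∈ W | G.Adj v u} : ℝ) = t * #W := by
    rw [← htW, card_interedges_eq_sum, Nat.cast_sum]
  have hcs : t ^ 2 * #W ≤ ∑ v ∈ W, (#(G.interedges {u ∈ W | G.Adj v u} W) : ℝ) := by
    have h : (#(G.interedges W W) : ℝ) ^ 2
        ≤ #W * ∑ v ∈ W, (#(G.interedges {u ∈ W | G.Adj v u} W) : ℝ) :=
      mod_cast sq_card_interedges_le W
    rw [htW] at h
    exact le_of_mul_le_mul_left (by linarith) hn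
  simp only [shearerDrop]
  rw [sum_sub_distrib, ← sum_mul, ← sum_mul, ← mul_sum, sum_add_distrib, hdeg, sum_const,
    nsmul_one]
  calc (t * #W + #W) * (shearerFun t + t * shearerSlope t)
        - 2 * (∑ v ∈ W, (#(G.interedges {u ∈ W | G.Adj v u} W) : ℝ)) * shearerSlope t
      ≤ (t * #W + #W) * (shearerFun t + t * shearerSlope t)
        - 2 * (t ^ 2 * #W) * shearerSlope t := by
        gcongr
        exact shearerSlope_nonneg t
    _ = #W * ((t + 1) * shearerFun t + (t - t ^ 2) * shearerSlope t) := by ring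
    _ = #W := by rw [shearerFun_ode ht, mul_one]

section DecidableEq

variable [DecidableEq V]

variable (G) in
/-- The vertices of `W` outside the closed neighbourhood of `v`: what is left of `W` once `v` has
been put into an independent set. -/
def nonNeighbors (W : Finset V) (v : V) : Finset V := {u ∈ W | u ≠ v ∧ ¬ G.Adj v u}

theorem nonNeighbors_ssubset (hv : v ∈ W) : nonNeighbors G W v ⊂ W :=
  filter_ssubset.mpr ⟨v, hv, fun h ↦ h.1 rfl⟩

theorem card_nonNeighbors_add (hv : v ∈ W) :
    #(nonNeighbors G W v) + (#{u ∈ W | G.Adj v u} + 1) = #W := by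
  have hadj : {u ∈ W.erase v | G.Adj v u} = {u ∈ W | G.Adj v u} := by
    rw [filter_erase, erase_eq_of_notMem (by simp)]
  have hnot : {u ∈ W.erase v | ¬ G.Adj v u} = nonNeighbors G W v := by
    ext u
    simp only [nonNeighbors, mem_filter, mem_erase]
    tauto
  rw [← hadj, ← hnot, ← add_assoc, add_comm #_, card_filter_add_card_filter_not,
    card_erase_add_one hv]

theorem isIndepSet_insert_of_subset_nonNeighbors {I : Finset V} (hI : G.IsIndepSet (I : Set V))
    (hIW : I ⊆ nonNeighbors G W v) : G.IsIndepSet (insert v I : Finset V) := by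
  rw [coe_insert]
  refine hI.insert fun u hu _ ↦ ?_
  have hvu : ¬ G.Adj v u := (mem_filter.mp (hIW hu)).2.2
  exact ⟨hvu, fun huv ↦ hvu huv.symm⟩

theorem card_interedges_nonNeighbors_add_le (hG : G.CliqueFree 3) (W : Finset V) (v : V) :
    #(G.interedges (nonNeighbors G W v) (nonNeighbors G W v))
      + 2 * #(G.interedges {u ∈ W | G.Adj v u} W) ≤ #(G.interedges W W) := by
  refine card_interedges_add_two_mul_le ?_ (filter_subset _ _) (filter_subset _ _) ?_
  · exact (G.isIndepSet_neighborSet_of_triangleFree hG v).mono fun u hu ↦ (mem_filter.mp hu).2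
  · exact disjoint_filter.mpr fun u _ hu ↦ hu.2

theorem shearerTangent_le_nonNeighbors_add_shearerDrop (hG : G.CliqueFree 3) (a : ℝ)
    (hv : v ∈ W) :
    shearerTangent a #W #(G.interedges W W)
      ≤ shearerTangent a #(nonNeighbors G W v)
          #(G.interedges (nonNeighbors G W v) (nonNeighbors G W v)) + shearerDrop G W v a := by
  have hcard : (#(nonNeighbors G W v) : ℝ) + (#{u ∈ W | G.Adj v u} + 1) = #W :=
    mod_cast card_nonNeighbors_add hv
  have hedges : (#(G.interedges (nonNeighbors G W v) (nonNeighbors G W v)) : ℝ)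
      + 2 * #(G.interedges {u ∈ W | G.Adj v u} W) ≤ #(G.interedges W W) :=
    mod_cast card_interedges_nonNeighbors_add_le hG W v
  rw [shearerTangent, shearerTangent, shearerDrop, ← hcard]
  linarith [mul_le_mul_of_nonneg_left hedges (shearerSlope_nonneg a)]

theorem exists_shearerTangent_le_one_add (hG : G.CliqueFree 3) (hW : W.Nonempty) {t : ℝ}
    (ht : 0 < t) (htW : (#(G.interedges W W) : ℝ) = t * #W) :
    ∃ v ∈ W, shearerTangent t #W #(G.interedges W W)
      ≤ 1 + shearerTangent t #(nonNeighbors G W v)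
          #(G.interedges (nonNeighbors G W v) (nonNeighbors G W v)) := by
  obtain ⟨v, hv, hdrop⟩ := exists_le_of_sum_le (g := fun _ ↦ (1 : ℝ)) hW <|
    (sum_shearerDrop_le_card hW ht htW).trans_eq (by simp)
  exact ⟨v, hv, by linarith [shearerTangent_le_nonNeighbors_add_shearerDrop hG t hv]⟩

end DecidableEq

theorem exists_isIndepSet_shearerTangent_le_card (hG : G.CliqueFree 3) (W : Finset V) {a : ℝ}
    (ha : 0 < a) :
    ∃ I ⊆ W, G.IsIndepSet (I : Set V) ∧ shearerTangent a #W #(G.interedges W W) ≤ #I := by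
  classical
  induction W using Finset.strongInduction generalizing a with
  | H W ih =>
  rcases (G.interedges W W).eq_empty_or_nonempty with hE | hE
  · refine ⟨W, subset_rfl, interedges_self_eq_empty_iff.mp hE, ?_⟩
    rw [hE, card_empty, Nat.cast_zero]
    exact shearerTangent_zero_le ha (Nat.cast_nonneg _)
  have hW : W.Nonempty := hE.imp' Prod.fst fun _ he ↦ (G.mem_interedges_iff.mp he).1
  -- Averaging the drop over `v` needs the tangent at the average degree of `W` itself, so `a`
  -- changes in each step.
  have hm : (0 : ℝ) < #(G.interedges W W) := mod_cast hE.card_pos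
  have hn : (0 : ℝ) < #W := mod_cast hW.card_pos
  obtain ⟨v, hv, hgain⟩ :=
    exists_shearerTangent_le_one_add (G := G) hG hW (div_pos hm hn) (div_mul_cancel₀ _ hn.ne').symm
  obtain ⟨I, hIW, hI, hcard⟩ := ih _ (nonNeighbors_ssubset (G := G) hv) (div_pos hm hn)
  have hvI : v ∉ I := fun h ↦ (mem_filter.mp (hIW h)).2.1 rfl
  refine ⟨insert v I, insert_subset hv (hIW.trans (filter_subset _ _)),
    isIndepSet_insert_of_subset_nonNeighbors hI hIW, ?_⟩
  rw [card_insert_of_notMem hvI, Nat.cast_succ]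
  linarith [shearerTangent_le_shearerTangent_div ha hn hm]

end Induction

section Sampling

open Finset

variable {V : Type*} [Fintype V] [DecidableEq V] {p : ℝ}

/-- The probability that a random subset of `V`, to which each element belongs independently with
probability `p`, is equal to `W`. -/
noncomputable def bernoulliWeight (p : ℝ) (W : Finset V) : ℝ := p ^ #W * (1 - p) ^ #Wᶜ

/-- The expectation of `g` on a random subset of `V`, to which each element belongs independently
with probability `p`. -/
noncomputable def bernoulliMean (p : ℝ) (g : Finset V → ℝ) : ℝ := ∑ W, bernoulliWeight p W * g W

theorem bernoulliWeight_nonneg (hp : 0 ≤ p) (hp1 : p ≤ 1) (W : Finset V) :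
    0 ≤ bernoulliWeight p W :=
  mul_nonneg (pow_nonneg hp _) (pow_nonneg (sub_nonneg.mpr hp1) _)

theorem sum_bernoulliWeight_superset (p : ℝ) (I : Finset V) :
    ∑ W with I ⊆ W, bernoulliWeight p W = p ^ #I := by
  have hweight (W : Finset V) : (∏ _i ∈ W, p) * ∏ i ∈ univ \ W, (if i ∈ I then 0 else 1 - p)
      = if I ⊆ W then bernoulliWeight p W else 0 := by
    rw [prod_const, ← compl_eq_univ_sdiff]
    split_ifs with hIW
    · rw [prod_congr rfl fun i hi ↦ if_neg fun hiI ↦ mem_compl.mp hi (hIW hiI), prod_const,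
        bernoulliWeight]
    · obtain ⟨i, hiI, hiW⟩ := not_subset.mp hIW
      exact mul_eq_zero_of_right _ (prod_eq_zero (mem_compl.mpr hiW) (if_pos hiI))
  calc ∑ W with I ⊆ W, bernoulliWeight p W
      = ∏ i, (p + if i ∈ I then 0 else 1 - p) := by
        rw [prod_add, powerset_univ, sum_filter]
        exact sum_congr rfl fun W _ ↦ (hweight W).symm
    _ = ∏ i, if i ∈ I then p else 1 := by
        congr! 1 with i
        split_ifs <;> ring
    _ = p ^ #I := by rw [prod_ite_mem, univ_inter, prod_const]

theorem sum_bernoulliWeight (p : ℝ) : ∑ W : Finset V, bernoulliWeight p W = 1 := by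
  simpa using sum_bernoulliWeight_superset (V := V) p ∅

theorem bernoulliMean_sum_filter_subset {ι : Type*} (p : ℝ) (S : Finset ι) (F : ι → Finset V)
    (c : ι → ℝ) :
    bernoulliMean p (fun W ↦ ∑ i ∈ S with F i ⊆ W, c i) = ∑ i ∈ S, c i * p ^ #(F i) := by
  simp only [bernoulliMean, sum_filter, mul_sum]
  rw [sum_comm]
  refine sum_congr rfl fun i _ ↦ ?_
  rw [← sum_bernoulliWeight_superset, mul_sum, sum_filter]
  simp only [mul_ite, mul_zero, mul_comm]

theorem bernoulliMean_card (p : ℝ) :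
    bernoulliMean p (fun W : Finset V ↦ (#W : ℝ)) = p * Fintype.card V := by
  simpa [mul_comm] using bernoulliMean_sum_filter_subset p univ (fun v : V ↦ {v}) fun _ ↦ 1

theorem bernoulliMean_card_interedges (G : SimpleGraph V) [DecidableRel G.Adj] (p : ℝ) :
    bernoulliMean p (fun W ↦ (#(G.interedges W W) : ℝ)) = p ^ 2 * #(G.interedges univ univ) := by
  have hfilter (W : Finset V) :
      G.interedges W W = {e ∈ G.interedges univ univ | {e.1, e.2} ⊆ W} := by
    ext e
    simp only [SimpleGraph.mem_interedges_iff, mem_filter, insert_subset_iff,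
      singleton_subset_iff, mem_univ, true_and]
    tauto
  have hpair (e : V × V) (he : e ∈ G.interedges univ univ) : #{e.1, e.2} = 2 :=
    card_pair (G.mem_interedges_iff.mp he).2.2.ne
  calc bernoulliMean p (fun W ↦ (#(G.interedges W W) : ℝ))
      = bernoulliMean p fun W ↦ ∑ e ∈ G.interedges univ univ with {e.1, e.2} ⊆ W, (1 : ℝ) := by
        simp only [← hfilter, sum_const, nsmul_one]
    _ = ∑ e ∈ G.interedges univ univ, 1 * p ^ #{e.1, e.2} := bernoulliMean_sum_filter_subset ..
    _ = p ^ 2 * #(G.interedges univ univ) := by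
        rw [sum_congr rfl fun e he ↦ by rw [hpair e he, one_mul], sum_const, nsmul_eq_mul,
          mul_comm]

theorem bernoulliMean_shearerTangent (G : SimpleGraph V) [DecidableRel G.Adj] (p a : ℝ) :
    bernoulliMean p (fun W ↦ shearerTangent a #W #(G.interedges W W))
      = shearerTangent a (p * Fintype.card V) (p ^ 2 * #(G.interedges univ univ)) := by
  rw [← bernoulliMean_card, ← bernoulliMean_card_interedges]
  simp only [bernoulliMean, shearerTangent, mul_sum, ← sum_add_distrib, ← sum_sub_distrib]
  exact sum_congr rfl fun W _ ↦ by ring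

theorem rpow_bernoulliMean_le (hp : 0 ≤ p) (hp1 : p ≤ 1) {b : ℝ} (hb : 0 < b)
    (g : Finset V → ℝ) : b ^ bernoulliMean p g ≤ bernoulliMean p fun W ↦ b ^ g W :=
  (convexOn_rpow_left hb).map_sum_le (fun W _ ↦ bernoulliWeight_nonneg hp hp1 W)
    (sum_bernoulliWeight p) fun _ _ ↦ Set.mem_univ _

theorem inv_rpow_bernoulliMean_le_card (hp : 0 < p) (hp1 : p ≤ 1) {𝒜 : Finset (Finset V)}
    {g : Finset V → ℝ} (hg : ∀ W, ∃ I ∈ 𝒜, I ⊆ W ∧ g W ≤ #I) :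
    p⁻¹ ^ bernoulliMean p g ≤ #𝒜 := by
  have hsample (W : Finset V) : p⁻¹ ^ g W ≤ ∑ I ∈ 𝒜 with I ⊆ W, p⁻¹ ^ #I := by
    obtain ⟨I, hI, hIW, hgI⟩ := hg W
    calc p⁻¹ ^ g W ≤ p⁻¹ ^ (#I : ℝ) :=
          Real.rpow_le_rpow_of_exponent_le (one_le_inv_iff₀.mpr ⟨hp, hp1⟩) hgI
      _ = p⁻¹ ^ #I := Real.rpow_natCast _ _
      _ ≤ ∑ I ∈ 𝒜 with I ⊆ W, p⁻¹ ^ #I :=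
          single_le_sum (f := fun I : Finset V ↦ p⁻¹ ^ #I) (fun _ _ ↦ by positivity)
            (mem_filter.mpr ⟨hI, hIW⟩)
  calc p⁻¹ ^ bernoulliMean p g
      ≤ bernoulliMean p fun W ↦ p⁻¹ ^ g W := rpow_bernoulliMean_le hp.le hp1 (inv_pos.mpr hp) g
    _ ≤ bernoulliMean p fun W ↦ ∑ I ∈ 𝒜 with I ⊆ W, p⁻¹ ^ #I :=
        sum_le_sum fun W _ ↦
          mul_le_mul_of_nonneg_left (hsample W) (bernoulliWeight_nonneg hp.le hp1 W)
    _ = ∑ I ∈ 𝒜, p⁻¹ ^ #I * p ^ #I := bernoulliMean_sum_filter_subset p 𝒜 id _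
    _ = #𝒜 := by simp [hp.ne']

end Sampling

section Counting

open Finset

variable {V : Type*} [Fintype V] {G : SimpleGraph V}

theorem two_pow_card_le_numIndepSets {I : Finset V} (hI : G.IsIndepSet (I : Set V)) :
    2 ^ #I ≤ G.numIndepSets := by
  classical
  rw [← card_powerset]
  exact card_le_card fun s hs ↦
    mem_filter.mpr ⟨mem_univ _, hI.mono (coe_subset.mpr (mem_powerset.mp hs))⟩

theorem one_le_numIndepSets (G : SimpleGraph V) : 1 ≤ G.numIndepSets :=
  two_pow_card_le_numIndepSets (I := ∅) (by simp)

theorem card_mul_avgDegree (G : SimpleGraph V) [DecidableRel G.Adj] :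
    Fintype.card V * G.avgDegree = ∑ v, (G.degree v : ℝ) := by
  rcases isEmpty_or_nonempty V with _ | _
  · simp
  · rw [SimpleGraph.avgDegree, mul_div_cancel₀ _ (by positivity)]
    convert rfl

theorem card_interedges_univ (G : SimpleGraph V) [DecidableRel G.Adj] :
    #(G.interedges univ univ) = Fintype.card V * G.avgDegree := by
  rw [card_mul_avgDegree, card_interedges_eq_sum, Nat.cast_sum]
  simp only [SimpleGraph.card_neighborFinset_eq_degree, ← SimpleGraph.neighborFinset_eq_filter]

theorem exists_avgDegree_le_degree [Nonempty V] (G : SimpleGraph V) [DecidableRel G.Adj] :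
    ∃ v, G.avgDegree ≤ G.degree v := by
  obtain ⟨v, -, hv⟩ : ∃ v ∈ (univ : Finset V), G.avgDegree ≤ G.degree v := by
    refine exists_le_of_sum_le univ_nonempty ?_
    rw [sum_const, nsmul_eq_mul, card_univ, card_mul_avgDegree]
  exact ⟨v, hv⟩

theorem two_rpow_avgDegree_le_numIndepSets (hG : G.CliqueFree 3) :
    (2 : ℝ) ^ G.avgDegree ≤ G.numIndepSets := by
  classical
  rcases isEmpty_or_nonempty V with _ | _
  · simpa [SimpleGraph.avgDegree] using one_le_numIndepSets G
  obtain ⟨v, hv⟩ := exists_avgDegree_le_degree G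
  have hN : G.IsIndepSet (G.neighborFinset v : Set V) := by
    rw [G.coe_neighborFinset]
    exact G.isIndepSet_neighborSet_of_triangleFree hG v
  calc (2 : ℝ) ^ G.avgDegree ≤ (2 : ℝ) ^ (G.degree v : ℝ) :=
        Real.rpow_le_rpow_of_exponent_le one_le_two hv
    _ = (2 ^ #(G.neighborFinset v) : ℕ) := by
        rw [Real.rpow_natCast, G.card_neighborFinset_eq_degree, Nat.cast_pow, Nat.cast_two]
    _ ≤ G.numIndepSets := Nat.cast_le.mpr (two_pow_card_le_numIndepSets hN)

theorem inv_rpow_shearerTangent_le_numIndepSets (hG : G.CliqueFree 3) {p a : ℝ} (hp : 0 < p)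
    (hp1 : p ≤ 1) (ha : 0 < a) :
    p⁻¹ ^ shearerTangent a (p * Fintype.card V) (p ^ 2 * (Fintype.card V * G.avgDegree))
      ≤ G.numIndepSets := by
  classical
  rw [← card_interedges_univ, ← bernoulliMean_shearerTangent]
  refine inv_rpow_bernoulliMean_le_card hp hp1 fun W ↦ ?_
  obtain ⟨I, hIW, hI, hcard⟩ := exists_isIndepSet_shearerTangent_le_card hG W ha
  exact ⟨I, mem_filter.mpr ⟨mem_univ _, hI⟩, hIW, hcard⟩

/-- The logarithm of the lower bound for the number of independent sets of a triangle-free graph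
with `n` vertices and average degree `t` which comes from sampling vertices. -/
noncomputable def samplingExponent (n t : ℝ) : ℝ :=
  1 / 2 * (n / t) * Real.log t * (1 / 2 * Real.log t - 1)

theorem samplingExponent_sq (n a : ℝ) :
    samplingExponent n (a ^ 2) = Real.log a * ((Real.log a - 1) / a * (a⁻¹ * n)) := by
  rw [samplingExponent, Real.log_pow, Nat.cast_two]
  ring

theorem mul_le_shearerTangent_inv {a n t : ℝ} (ha : 0 < a) (hn : 0 ≤ n) (ht : t ≤ a ^ 2) :
    (Real.log a - 1) / a * (a⁻¹ * n) ≤ shearerTangent a (a⁻¹ * n) (a⁻¹ ^ 2 * (n * t)) := by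
  have hm : a⁻¹ ^ 2 * (n * t) ≤ a * (a⁻¹ * n) := by
    calc a⁻¹ ^ 2 * (n * t) ≤ a⁻¹ ^ 2 * (n * a ^ 2) := by gcongr
      _ = a * (a⁻¹ * n) := by field_simp
  calc (Real.log a - 1) / a * (a⁻¹ * n) ≤ shearerFun a * (a⁻¹ * n) := by
        gcongr
        exact log_sub_one_div_le_shearerFun ha
    _ ≤ shearerTangent a (a⁻¹ * n) (a⁻¹ ^ 2 * (n * t)) :=
        le_add_of_nonneg_right (mul_nonneg (shearerSlope_nonneg a) (sub_nonneg.mpr hm))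

theorem exp_samplingExponent_le_numIndepSets (hG : G.CliqueFree 3) {t : ℝ} (ht : 1 ≤ t)
    (hGt : G.avgDegree ≤ t) :
    Real.exp (samplingExponent (Fintype.card V) t) ≤ G.numIndepSets := by
  have ha : 1 ≤ √t := Real.one_le_sqrt.mpr ht
  have ha0 : 0 < √t := zero_lt_one.trans_le ha
  have hsq : √t ^ 2 = t := Real.sq_sqrt (zero_le_one.trans ht)
  have hcount := inv_rpow_shearerTangent_le_numIndepSets hG (inv_pos.mpr ha0)
    (inv_le_one_of_one_le₀ ha) ha0
  rw [inv_inv, Real.rpow_def_of_pos ha0] at hcount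
  refine (Real.exp_le_exp.mpr ?_).trans hcount
  rw [← hsq, samplingExponent_sq, hsq]
  exact mul_le_mul_of_nonneg_left
    (mul_le_shearerTangent_inv ha0 (Nat.cast_nonneg _) (hGt.trans_eq hsq.symm)) (Real.log_nonneg ha)

end Counting

section Asymptotics

open Filter Topology

/-- The claimed exponent `√(n log 2) log n / 4`, without its factor `1 - ε(n)`. -/
noncomputable def limitingExponent (n : ℕ) : ℝ := √(n * Real.log 2) * Real.log n / 4

/-- The average degree `t` at which `2 ^ t` is equal to `exp (limitingExponent n)`; the bound from
sampling has asymptotically the same exponent there. -/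
noncomputable def balancedDegree (n : ℕ) : ℝ := limitingExponent n / Real.log 2

/-- The ratio of the logarithms of the two lower bounds at the balanced degree. -/
noncomputable def balancedRatio (n : ℕ) : ℝ :=
  samplingExponent n (balancedDegree n) / limitingExponent n

/-- The factor `1 - ε(n)` of the asymptotic bound; it is `0` as long as the bound from sampling is
not available at the balanced degree. -/
noncomputable def balancedFactor (n : ℕ) : ℝ :=
  if 1 ≤ balancedDegree n then min 1 (balancedRatio n) else 0

theorem balancedDegree_mul_log_two (n : ℕ) :
    balancedDegree n * Real.log 2 = limitingExponent n :=
  div_mul_cancel₀ _ (Real.log_pos one_lt_two).ne'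

theorem balancedDegree_sq_mul_log_two (n : ℕ) :
    balancedDegree n ^ 2 * Real.log 2 = n * Real.log n ^ 2 / 16 := by
  rw [balancedDegree, limitingExponent, div_pow, div_pow, mul_pow, Real.sq_sqrt (by positivity)]
  field_simp
  norm_num

theorem tendsto_log_natCast : Tendsto (fun n : ℕ ↦ Real.log n) atTop atTop :=
  Real.tendsto_log_atTop.comp tendsto_natCast_atTop_atTop

theorem tendsto_limitingExponent : Tendsto limitingExponent atTop atTop :=
  ((Real.tendsto_sqrt_atTop.comp (tendsto_natCast_atTop_atTop.atTop_mul_const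
    (Real.log_pos one_lt_two))).atTop_mul_atTop₀ tendsto_log_natCast).atTop_div_const
      four_pos

theorem tendsto_balancedDegree : Tendsto balancedDegree atTop atTop :=
  tendsto_limitingExponent.atTop_div_const (Real.log_pos one_lt_two)

theorem log_balancedDegree {n : ℕ} (hn : 1 < n) :
    Real.log (balancedDegree n)
      = Real.log n / 2 + Real.log (Real.log n) - (Real.log (Real.log 2) / 2 + Real.log 4) := by
  have hn0 : (0 : ℝ) < n := by positivity
  have hlogn : 0 < Real.log n := Real.log_pos (mod_cast hn)
  have hlog2 : 0 < Real.log 2 := Real.log_pos one_lt_two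
  rw [balancedDegree, limitingExponent, Real.log_div (by positivity) hlog2.ne',
    Real.log_div (by positivity) four_ne_zero, Real.log_mul (by positivity) hlogn.ne',
    Real.log_sqrt (by positivity), Real.log_mul hn0.ne' hlog2.ne']
  ring

theorem tendsto_log_balancedDegree_div_log :
    Tendsto (fun n : ℕ ↦ Real.log (balancedDegree n) / Real.log n) atTop (𝓝 (1 / 2)) := by
  have hloglog : Tendsto (fun n : ℕ ↦ Real.log (Real.log n) / Real.log n) atTop (𝓝 0) :=
    Real.isLittleO_log_id_atTop.tendsto_div_nhds_zero.comp tendsto_log_natCast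
  have hconst : Tendsto (fun n : ℕ ↦ (Real.log (Real.log 2) / 2 + Real.log 4) / Real.log n)
      atTop (𝓝 0) := tendsto_const_nhds.div_atTop tendsto_log_natCast
  have hsum := (hloglog.const_add (1 / 2)).sub hconst
  rw [add_zero, sub_zero] at hsum
  refine hsum.congr' ?_
  filter_upwards [eventually_gt_atTop 1] with n hn
  have hlogn : 0 < Real.log n := Real.log_pos (mod_cast hn)
  rw [log_balancedDegree hn]
  field_simp

theorem balancedRatio_eq {n : ℕ} (hn : 1 < n) :
    balancedRatio n = 4 * (Real.log (balancedDegree n) / Real.log n)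
      * (Real.log (balancedDegree n) / Real.log n - 2 / Real.log n) := by
  have hlogn : 0 < Real.log n := Real.log_pos (mod_cast hn)
  have hT : balancedDegree n ≠ 0 := by
    rw [balancedDegree, limitingExponent]
    positivity
  have hsq := balancedDegree_sq_mul_log_two n
  rw [balancedRatio, samplingExponent, ← balancedDegree_mul_log_two]
  generalize balancedDegree n = T at *
  field_simp
  linear_combination (-16 * Real.log T * (Real.log T - 2)) * hsq

theorem tendsto_balancedRatio : Tendsto balancedRatio atTop (𝓝 1) := by
  have hprod := (tendsto_log_balancedDegree_div_log.const_mul 4).mul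
    (tendsto_log_balancedDegree_div_log.sub
      ((tendsto_const_nhds (x := (2 : ℝ))).div_atTop tendsto_log_natCast))
  rw [show (4 : ℝ) * (1 / 2) * (1 / 2 - 0) = 1 by norm_num] at hprod
  refine hprod.congr' ?_
  filter_upwards [eventually_gt_atTop 1] with n hn using (balancedRatio_eq hn).symm

theorem tendsto_balancedFactor : Tendsto balancedFactor atTop (𝓝 1) := by
  have hmin := (tendsto_const_nhds (x := (1 : ℝ))).min tendsto_balancedRatio
  rw [min_self] at hmin
  refine hmin.congr' ?_
  filter_upwards [tendsto_balancedDegree.eventually_ge_atTop 1] with n hn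
  rw [balancedFactor, if_pos hn]

theorem balancedFactor_mul_limitingExponent {n : ℕ} (hn : 1 ≤ balancedDegree n) :
    balancedFactor n * limitingExponent n
      = min (balancedDegree n * Real.log 2) (samplingExponent n (balancedDegree n)) := by
  have hpos : 0 < limitingExponent n := by
    rw [← balancedDegree_mul_log_two]
    exact mul_pos (zero_lt_one.trans_le hn) (Real.log_pos one_lt_two)
  rw [balancedFactor, if_pos hn, min_mul_of_nonneg _ _ hpos.le, one_mul, balancedRatio,
    div_mul_cancel₀ _ hpos.ne', balancedDegree_mul_log_two]

theorem exp_min_le_numIndepSets {V : Type*} [Fintype V] {G : SimpleGraph V} (hG : G.CliqueFree 3)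
    {t : ℝ} (ht : 1 ≤ t) :
    Real.exp (min (t * Real.log 2) (samplingExponent (Fintype.card V) t)) ≤ G.numIndepSets := by
  rcases le_total G.avgDegree t with hGt | hGt
  · exact (Real.exp_le_exp.mpr (min_le_right _ _)).trans
      (exp_samplingExponent_le_numIndepSets hG ht hGt)
  · calc Real.exp (min (t * Real.log 2) (samplingExponent (Fintype.card V) t))
        ≤ Real.exp (Real.log 2 * t) := by
          rw [mul_comm t]
          exact Real.exp_le_exp.mpr (min_le_left _ _)
      _ = 2 ^ t := (Real.rpow_def_of_pos two_pos t).symm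
      _ ≤ 2 ^ G.avgDegree := Real.rpow_le_rpow_of_exponent_le one_le_two hGt
      _ ≤ G.numIndepSets := two_rpow_avgDegree_le_numIndepSets hG

theorem exp_balancedFactor_mul_limitingExponent_le_numIndepSets {V : Type*} [Fintype V]
    {G : SimpleGraph V} (hG : G.CliqueFree 3) :
    Real.exp (balancedFactor (Fintype.card V) * limitingExponent (Fintype.card V))
      ≤ G.numIndepSets := by
  by_cases hn : 1 ≤ balancedDegree (Fintype.card V)
  · rw [balancedFactor_mul_limitingExponent hn]
    exact exp_min_le_numIndepSets hG hn
  · rw [balancedFactor, if_neg hn, zero_mul, Real.exp_zero]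
    exact mod_cast one_le_numIndepSets G

end Asymptotics

theorem exp_mul_le_of_exp_le {θ x y : ℝ} (hθ : 0 ≤ θ) (hθ1 : θ ≤ 1) (hy : 1 ≤ y)
    (hxy : Real.exp x ≤ y) : Real.exp (θ * x) ≤ y := by
  calc Real.exp (θ * x) = Real.exp x ^ θ := by rw [mul_comm, Real.exp_mul]
    _ ≤ y ^ θ := by gcongr
    _ ≤ y ^ (1 : ℝ) := Real.rpow_le_rpow_of_exponent_le hy hθ1
    _ = y := Real.rpow_one y

theorem natCast_rpow_le_one (n : ℕ) {s : ℝ} (hs : s ≤ 0) : (n : ℝ) ^ s ≤ 1 := by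
  rcases n.eq_zero_or_pos with rfl | hn
  · rw [Nat.cast_zero]
    exact Real.zero_rpow_le_one s
  · exact Real.rpow_le_one_of_one_le_of_nonpos (mod_cast hn) hs

theorem mainTheorem2 :
    (∀ (V : Type*) [Fintype V] (G : SimpleGraph V), G.CliqueFree 3 →
      ∀ (n : ℕ) (t : ℝ), n = Fintype.card V → t = G.avgDegree →
        (1 ≤ t →
          max
            (Real.exp ((1 - (n : ℝ) ^ (-(1 / 12 : ℝ))) * (1 / 2) * ((n : ℝ) / t) * Real.log t *
              ((1 / 2) * Real.log t - 1)))
            ((2 : ℝ) ^ t)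
          ≤ (G.numIndepSets : ℝ)) ∧
        (2 : ℝ) ^ t ≤ (G.numIndepSets : ℝ)) ∧
    (∃ ε : ℕ → ℝ, Filter.Tendsto ε Filter.atTop (nhds 0) ∧
      ∀ (V : Type*) [Fintype V] (H : SimpleGraph V), H.CliqueFree 3 →
        ∀ n : ℕ, n = Fintype.card V →
          Real.exp ((1 - ε n) * (Real.sqrt ((n : ℝ) * Real.log 2) * Real.log (n : ℝ) / 4))
            ≤ (H.numIndepSets : ℝ)) := by
  refine ⟨?_, fun n ↦ 1 - balancedFactor n, ?_, ?_⟩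
  · rintro V _ G hG n _ rfl rfl
    refine ⟨fun ht ↦ max_le ?_ (two_rpow_avgDegree_le_numIndepSets hG),
      two_rpow_avgDegree_le_numIndepSets hG⟩
    set n := Fintype.card V
    have hfactor : (n : ℝ) ^ (-(1 / 12 : ℝ)) ≤ 1 := natCast_rpow_le_one n (by norm_num)
    have hexp := exp_mul_le_of_exp_le (sub_nonneg.mpr hfactor) (sub_le_self 1 (by positivity))
      (mod_cast one_le_numIndepSets G) (exp_samplingExponent_le_numIndepSets hG ht le_rfl)
    simpa only [samplingExponent, ← mul_assoc] using hexp
  · simpa using tendsto_balancedFactor.const_sub 1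
  · rintro V _ H hH n rfl
    rw [sub_sub_cancel]
    exact exp_balancedFactor_mul_limitingExponent_le_numIndepSets hH
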